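/- Let $d\ge 1$ and $k\ge 0$ be integers and let $\mathbb S^d$ be the unit sphere in $\mathbb R^{d+1}$. Let $A\subseteq\mathbb S^d$ be a finite set that is generic (no $d+1$ points of $A$ lie on a common $(d-1)$-dimensional great-sphere and no $d+2$ points of $A$ lie on a common $(d-1)$-dimensional sphere in $\mathbb S^d$) and $k$-balanced (every open hemisphere contains at least $k+1$ points of $A$). A point $x\in\mathbb S^d\setminus A$ is called generic with respect to $A$ if $A\cup\{x\}$ is generic. The spherical $d$-simplex spanned by $d+1$ points of $A$ (the central projection to $\mathbb S^d$ of their convex hull in $\mathbb R^{d+1}$) is called $k$-hefty if the smaller of the two open balls in $\mathbb S^d$ bounded by the unique $(d-1)$-sphere through these $d+1$ points contains exactly $k$ points of $A$. We say that a family of such simplices covers a set $U\subseteq\mathbb S^d$ exactly $N$ times if every point of $U$ belongs to at least $N$ simplices of the family, every point of $U$ that is generic with respect to $A$ belongs to exactly $N$ of them, almost every point of $U$ (with respect to surface measure) belongs to exactly $N$ of them, and every point of $U$ on the boundary of a simplex of the family belongs to more than $N$ of them. Then the $k$-hefty simplices of $A$ cover $\mathbb S^d$ exactly $\binom{d+k}{d}$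 times. Moreover, for every $a\in A$, the $k$-hefty simplices of $A$ with vertex $a$ cover every sufficiently small neighborhood of $a$ exactly $\binom{d+k-1}{d-1}$ times; that is, there is $\varepsilon>0$ such that this holds for every neighborhood of $a$ contained in the ball of radius $\varepsilon$ around $a$. -/

import Mathlib

open Set Metric Topology MeasureTheory

/-- The unit sphere `S^d` in `ℝ^(d+1)`. -/
abbrev USphere (d : ℕ) : Type := sphere (0 : EuclideanSpace ℝ (Fin (d + 1))) 1

/-- The inner product in `ℝ^(d+1)` of two points of `S^d`. -/
noncomputable def sinner {d : ℕ} (x y : USphere d) : ℝ :=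
  inner ℝ (x : EuclideanSpace ℝ (Fin (d + 1))) (y : EuclideanSpace ℝ (Fin (d + 1)))

/-- The `(d-1)`-sphere `{x | ⟨x, u⟩ = c}` of `S^d` with centre `u`, i.e. the intersection of `S^d`
with an affine hyperplane. For `c = 0` it is a great-sphere. -/
def subsphere {d : ℕ} (u : USphere d) (c : ℝ) : Set (USphere d) := {x | sinner x u = c}

/-- The open `d`-ball `{x | c < ⟨x, u⟩}` of `S^d` with centre `u`, bounded by `subsphere u c`.
For `c = 0` it is an open hemisphere; for `0 < c` it is the smaller of the two open balls bounded
by `subsphere u c`. -/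
def openCap {d : ℕ} (u : USphere d) (c : ℝ) : Set (USphere d) := {x | c < sinner x u}

/-- `A` is generic: no `d+1` of its points belong to a common `(d-1)`-dimensional great-sphere, and
no `d+2` of its points belong to a common `(d-1)`-dimensional sphere in `S^d`. -/
def IsGenericOnSphere {d : ℕ} (A : Set (USphere d)) : Prop :=
  (∀ T : Finset (USphere d), (T : Set (USphere d)) ⊆ A → T.card = d + 1 →
    ¬ ∃ u : USphere d, (T : Set (USphere d)) ⊆ subsphere u 0) ∧
  (∀ T : Finset (USphere d), (T : Set (USphere d)) ⊆ A → T.card = d + 2 →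
    ¬ ∃ (u : USphere d) (c : ℝ), (T : Set (USphere d)) ⊆ subsphere u c)

/-- `x` is generic with respect to `A`: it is not in `A`, and `A ∪ {x}` is generic. -/
def IsGenericWrt {d : ℕ} (A : Set (USphere d)) (x : USphere d) : Prop :=
  x ∉ A ∧ IsGenericOnSphere (insert x A)

/-- `A` is `k`-balanced: every open hemisphere contains at least `k+1` points of `A`. -/
def IsBalanced {d : ℕ} (k : ℕ) (A : Set (USphere d)) : Prop :=
  ∀ u : USphere d, ((k + 1 : ℕ) : ℕ∞) ≤ (A ∩ openCap u 0).encard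

/-- The spherical simplex with vertex set `T`: the central projection to `S^d` of the Euclidean
simplex spanned by `T`. -/
def sphericalSimplex {d : ℕ} (T : Finset (USphere d)) : Set (USphere d) :=
  {x | ∃ r : ℝ, 0 < r ∧ r • (x : EuclideanSpace ℝ (Fin (d + 1))) ∈
    convexHull ℝ ((fun v : USphere d => (v : EuclideanSpace ℝ (Fin (d + 1)))) '' T)}

/-- The (vertex sets of the) `k`-hefty simplices of `A`: sets of `d+1` points of `A` lying on a
`(d-1)`-sphere of `S^d`, which is not a great-sphere, such that the smaller of the two open balls
bounded by this sphere contains exactly `k` points of `A`. If `A` is generic, `d+1` points of `A`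
lie on exactly one `(d-1)`-sphere, and that is not a great-sphere. -/
def heftySimplices {d : ℕ} (k : ℕ) (A : Set (USphere d)) : Set (Finset (USphere d)) :=
  {T | (T : Set (USphere d)) ⊆ A ∧ T.card = d + 1 ∧
    ∃ (u : USphere d) (c : ℝ), 0 < c ∧ (T : Set (USphere d)) ⊆ subsphere u c ∧
      (A ∩ openCap u c).encard = k}

/-- The number of simplices with vertex sets in `F` that contain the point `x`. -/
noncomputable def coverNumber {d : ℕ} (F : Set (Finset (USphere d))) (x : USphere d) : ℕ∞ :=
  {T | T ∈ F ∧ x ∈ sphericalSimplex T}.encard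

/-- The simplices in `F`, with vertices in `A`, cover `U ⊆ S^d` exactly `N` times: every point of
`U` is covered at least `N` times, every point of `U` that is generic with respect to `A` and
almost every point of `U` (in the surface measure) is covered exactly `N` times, and points of `U`
on the boundary of a simplex in `F` are covered more than `N` times. -/
def CoversExactly {d : ℕ} (A : Set (USphere d)) (F : Set (Finset (USphere d))) (N : ℕ)
    (U : Set (USphere d)) : Prop :=
  (∀ x ∈ U, (N : ℕ∞) ≤ coverNumber F x) ∧
  (∀ x ∈ U, IsGenericWrt A x → coverNumber F x = N) ∧
  (∀ᵐ x ∂(volume : Measure (EuclideanSpace ℝ (Fin (d + 1)))).toSphere,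
    x ∈ U → coverNumber F x = N) ∧
  (∀ x ∈ U, (∃ T ∈ F, x ∈ frontier (sphericalSimplex T)) → (N : ℕ∞) < coverNumber F x)

/-! Fix a point x outside all linear spans of at most d points of A, and let n = |A|. Delete a set M
of at most k points. By balance, A \ M still meets every open hemisphere, so its convex hull has the
origin in its interior, and the ray through x leaves it through exactly one facet T, a simplex by
genericity (`existsUnique_delaunay`). Let O(T) be the set of points of A beyond the hyperplane of T.
Then T is a facet of the hull of A \ M iff T avoids M and O(T) ⊆ M. Hence each M selects exactly one
T covering x, and T is k-hefty iff |O(T)| = k.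

Counting the M of size m for each m ≤ k gives a triangular linear system for the numbers of T with
|O(T)| = j. It depends only on n and |T|, and a Vandermonde identity solves it: the numbers are
`multichoose (d + 1) j`. This is `Finset.card_filter_card_eq_multichoose`. Near a ∈ A, only sets M
avoiding a are deleted. All selected simplices then have vertex a, and the same count on A \ {a}
with d free vertices gives `multichoose d k`.

The points x treated so far are dense and of full measure. Since the simplices are closed and
finitely many, the bounds at all other points follow by semicontinuity
(`coversExactly_of_avoidsSpans`). -/

/-! ### The combinatorial count. -/

/-- Vandermonde for multisets: compare coefficients in (1-t)^(-D) (1-t)^(-E). The double induction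
uses the Pascal rule for `multichoose`. -/
theorem Nat.sum_antidiagonal_multichoose_mul (D E m : ℕ) :
    ∑ p ∈ Finset.HasAntidiagonal.antidiagonal m, D.multichoose p.1 * E.multichoose p.2 =
      (D + E).multichoose m := by
  induction D generalizing m with
  | zero =>
    cases m with
    | zero => simp
    | succ m => simp [Finset.Nat.sum_antidiagonal_succ]
  | succ D ihD =>
    induction m with
    | zero => simp
    | succ m ihm =>
      have h1 := ihD (m + 1)
      rw [Finset.Nat.sum_antidiagonal_succ] at h1 ⊢
      simp only [Nat.multichoose_succ_succ, add_mul, Finset.sum_add_distrib] at ihm ⊢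
      rw [show D + 1 + E = (D + E) + 1 by ring, Nat.multichoose_succ_succ,
        show D + E + 1 = D + 1 + E by ring, ← h1, ← ihm]
      simp [add_assoc]

/-- Removing O is a bijection onto the subsets of A \ T \ O of size m - |O|. -/
theorem Finset.card_filter_subset_disjoint_powersetCard {α : Type*} [DecidableEq α]
    {A T O : Finset α} (hT : T ⊆ A) (hO : O ⊆ A) (hTO : Disjoint T O) {m : ℕ}
    (hm : O.card ≤ m) :
    ((A.powersetCard m).filter fun M => O ⊆ M ∧ Disjoint M T).card =
      (A.card - T.card - O.card).choose (m - O.card) := by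
  have hOT : O ⊆ A \ T := Finset.subset_sdiff.2 ⟨hO, hTO.symm⟩
  rw [← Finset.card_sdiff_of_subset hT, ← Finset.card_sdiff_of_subset hOT,
    ← Finset.card_powersetCard]
  refine Finset.card_nbij' (fun M => M \ O) (fun M => M ∪ O) ?_ ?_ ?_ ?_
  · intro M hM
    simp only [Finset.coe_filter, Finset.mem_powersetCard, Set.mem_ofPred_eq] at hM
    obtain ⟨⟨h1, h2⟩, h3, h4⟩ := hM
    simp only [Finset.mem_coe, Finset.mem_powersetCard]
    refine ⟨Finset.sdiff_subset_sdiff (Finset.subset_sdiff.2 ⟨h1, h4⟩) le_rfl, ?_⟩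
    rw [Finset.card_sdiff_of_subset h3, h2]
  · intro M hM
    simp only [Finset.mem_coe, Finset.mem_powersetCard] at hM
    obtain ⟨h1, h2⟩ := hM
    have h3 := Finset.subset_sdiff.1 h1
    have h4 := Finset.subset_sdiff.1 h3.1
    simp only [Finset.coe_filter, Finset.mem_powersetCard, Set.mem_ofPred_eq]
    refine ⟨⟨Finset.union_subset h4.1 hO, ?_⟩, Finset.subset_union_right, ?_⟩
    · rw [Finset.card_union_of_disjoint h3.2, h2]; omega
    · exact Finset.disjoint_union_left.2 ⟨h4.2, hTO.symm⟩
  · intro M hM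
    simp only [Finset.coe_filter, Set.mem_ofPred_eq] at hM
    exact Finset.sdiff_union_of_subset hM.2.1
  · intro M hM
    simp only [Finset.mem_coe, Finset.mem_powersetCard] at hM
    exact Finset.union_sdiff_cancel_right (Finset.subset_sdiff.1 hM.1).2

/-- If every set of at most `k` elements of `A` contains `O i` and avoids `T i` for exactly one
index `i`, where all `T i` have the same cardinality `D`, then the number of indices with
`|O i| = k` depends on `D` and `k` only. -/
theorem Finset.card_filter_card_eq_multichoose {ι α : Type*} [DecidableEq α]
    (S : Finset ι) (A : Finset α) (T O : ι → Finset α) (D k : ℕ)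
    (hT : ∀ i ∈ S, T i ⊆ A) (hO : ∀ i ∈ S, O i ⊆ A) (hTO : ∀ i ∈ S, Disjoint (T i) (O i))
    (hcard : ∀ i ∈ S, (T i).card = D) (hk : k ≤ A.card)
    (h : ∀ M ⊆ A, M.card ≤ k → ∃! i, i ∈ S ∧ O i ⊆ M ∧ Disjoint M (T i)) :
    (S.filter fun i => (O i).card = k).card = D.multichoose k := by
  -- A k-set M and the T selected by it are disjoint in A. This keeps the natural subtractions below
  -- from truncating.
  have hn : D + k ≤ A.card := by
    obtain ⟨M, hM, hMk⟩ := Finset.exists_subset_card_eq hk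
    obtain ⟨i, ⟨hi, -, hd⟩, -⟩ := h M hM hMk.le
    rw [← hcard i hi, ← hMk, ← Finset.card_union_of_disjoint hd.symm]
    exact Finset.card_le_card (Finset.union_subset (hT i hi) hM)
  -- Double count of pairs (i, M) with |M| = m. The factor is C(n-D-j, m-j) with n = |A|, rewritten
  -- as a `multichoose` whose first argument does not depend on j, so that the sum is a convolution.
  have hcount : ∀ m ≤ k, ∑ p ∈ Finset.HasAntidiagonal.antidiagonal m,
      (S.filter fun i => (O i).card = p.1).card * (A.card - D - m + 1).multichoose p.2 =
        A.card.choose m := by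
    intro m hm
    have h1 : ∑ i ∈ S, ((A.powersetCard m).filter fun M => O i ⊆ M ∧ Disjoint M (T i)).card =
        A.card.choose m := by
      rw [← Finset.card_powersetCard, Finset.card_eq_sum_ones]
      simp only [Finset.card_filter]
      rw [Finset.sum_comm]
      refine Finset.sum_congr rfl fun M hM => ?_
      rw [Finset.mem_powersetCard] at hM
      rw [← Finset.card_filter, Finset.card_eq_one]
      obtain ⟨i, hi, hu⟩ := h M hM.1 (hM.2.trans_le hm)
      refine ⟨i, Finset.ext fun j => ?_⟩
      simp only [Finset.mem_filter, Finset.mem_singleton]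
      exact ⟨fun hj => hu j hj, fun hj => hj ▸ hi⟩
    rw [← h1, ← Finset.sum_filter_add_sum_filter_not S (fun i => (O i).card ≤ m),
      Finset.sum_eq_zero (s := S.filter fun i => ¬ (O i).card ≤ m), add_zero,
      Finset.Nat.sum_antidiagonal_eq_sum_range_succ
        (fun a b => (S.filter fun i => (O i).card = a).card *
          (A.card - D - m + 1).multichoose b),
      ← Finset.sum_fiberwise_of_maps_to (s := S.filter fun i => (O i).card ≤ m)
        (t := Finset.range (m + 1)) (g := fun i => (O i).card)]
    · refine Finset.sum_congr rfl fun j hj => ?_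
      have hj' : j ≤ m := Nat.lt_succ_iff.1 (Finset.mem_range.1 hj)
      rw [← smul_eq_mul, ← Finset.sum_const, Finset.filter_filter]
      refine Finset.sum_congr (Finset.filter_congr fun i _ => ?_) fun i hi => ?_
      · exact ⟨fun e => ⟨e ▸ hj', e⟩, fun e => e.2⟩
      · rw [Finset.mem_filter] at hi
        rw [Finset.card_filter_subset_disjoint_powersetCard (hT i hi.1) (hO i hi.1)
          (hTO i hi.1) (hi.2.2 ▸ hj'), hcard i hi.1, hi.2.2, Nat.multichoose_eq]
        congr 1
        omega
    · intro i hi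
      simpa [Nat.lt_succ_iff] using (Finset.mem_filter.1 hi).2
    · intro i hi
      rw [Finset.mem_filter] at hi
      refine Finset.card_eq_zero.2 (Finset.filter_eq_empty_iff.2 fun M hM hM' => hi.2 ?_)
      rw [← (Finset.mem_powersetCard.1 hM).2]
      exact Finset.card_le_card hM'.1
  have hmain : ∀ m ≤ k, (S.filter fun i => (O i).card = m).card = D.multichoose m := by
    intro m
    induction m using Nat.strong_induction_on with
    | _ m ih =>
      intro hm
      have h1 := hcount m hm
      -- The values `D.multichoose j` solve the same equation. The terms j < m agree by induction,
      -- and the coefficient of the term j = m is 1.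
      have h2 := Nat.sum_antidiagonal_multichoose_mul D (A.card - D - m + 1) m
      rw [Nat.multichoose_eq (D + _),
        show D + (A.card - D - m + 1) + m - 1 = A.card by omega, ← h1] at h2
      rw [Finset.Nat.sum_antidiagonal_eq_sum_range_succ
          (fun a b => (S.filter fun i => (O i).card = a).card *
            (A.card - D - m + 1).multichoose b),
        Finset.Nat.sum_antidiagonal_eq_sum_range_succ
          (fun a b => D.multichoose a * (A.card - D - m + 1).multichoose b),
        Finset.sum_range_succ, Finset.sum_range_succ,
        Finset.sum_congr rfl fun j hj => by
          rw [← ih j (Finset.mem_range.1 hj) ((Finset.mem_range.1 hj).le.trans hm)]] at h2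
      simpa using (Nat.add_left_cancel h2).symm
  exact hmain k le_rfl

/-! ### Convex hulls and spherical simplices. -/

/-- The ambient space `ℝ^(d+1)` of `S^d`. -/
abbrev Ambient (d : ℕ) : Type := EuclideanSpace ℝ (Fin (d + 1))

/-- The Euclidean simplex (or polytope) with vertex set `T`. -/
def euclideanHull {d : ℕ} (T : Finset (USphere d)) : Set (Ambient d) :=
  convexHull ℝ ((fun v : USphere d => (v : Ambient d)) '' T)

/-- The linear span of a finite set of points of the sphere. -/
def linearSpan {d : ℕ} (T : Finset (USphere d)) : Submodule ℝ (Ambient d) :=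
  Submodule.span ℝ ((fun v : USphere d => (v : Ambient d)) '' T)

/-- `x` avoids all linear spans of at most `d` points of `A`. -/
def AvoidsSpans {d : ℕ} (A : Finset (USphere d)) (x : USphere d) : Prop :=
  ∀ S ⊆ A, S.card ≤ d → (x : Ambient d) ∉ linearSpan S

section Hull
variable {d : ℕ}

theorem mem_sphericalSimplex {T : Finset (USphere d)} {x : USphere d} :
    x ∈ sphericalSimplex T ↔ ∃ r : ℝ, 0 < r ∧ r • (x : Ambient d) ∈ euclideanHull T := Iff.rfl

theorem USphere.norm_coe (x : USphere d) : ‖(x : Ambient d)‖ = 1 := by simp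

theorem USphere.inner_self (x : USphere d) : inner ℝ (x : Ambient d) (x : Ambient d) = 1 := by
  rw [real_inner_self_eq_norm_sq, x.norm_coe, one_pow]

theorem USphere.exists_smul_of_ne_zero {w : Ambient d} (hw : w ≠ 0) :
    ∃ u : USphere d, w = ‖w‖ • (u : Ambient d) := by
  have h : ‖w‖ ≠ 0 := norm_ne_zero_iff.2 hw
  refine ⟨⟨‖w‖⁻¹ • w, ?_⟩, ?_⟩
  · simp [norm_smul, h]
  · simp [smul_smul, h]

theorem convex_euclideanHull (T : Finset (USphere d)) : Convex ℝ (euclideanHull T) :=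
  convex_convexHull _ _

theorem isCompact_euclideanHull (T : Finset (USphere d)) : IsCompact (euclideanHull T) :=
  (T.finite_toSet.image _).isCompact_convexHull ℝ

theorem coe_mem_euclideanHull {T : Finset (USphere d)} {t : USphere d} (ht : t ∈ T) :
    (t : Ambient d) ∈ euclideanHull T :=
  subset_convexHull _ _ ⟨t, ht, rfl⟩

theorem mem_euclideanHull_iff {T : Finset (USphere d)} {y : Ambient d} :
    y ∈ euclideanHull T ↔ ∃ l : USphere d → ℝ, (∀ t ∈ T, 0 ≤ l t) ∧ ∑ t ∈ T, l t = 1 ∧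
      ∑ t ∈ T, l t • (t : Ambient d) = y := by
  classical
  have hinj : Function.Injective fun v : USphere d => (v : Ambient d) := Subtype.coe_injective
  unfold euclideanHull
  rw [← Finset.coe_image, Finset.mem_convexHull']
  constructor
  · rintro ⟨l, h0, h1, h2⟩
    rw [Finset.sum_image hinj.injOn] at h1 h2
    exact ⟨fun t => l t, fun t ht => h0 _ (Finset.mem_image_of_mem _ ht), h1, h2⟩
  · rintro ⟨l, h0, h1, h2⟩
    refine ⟨Function.extend (fun v : USphere d => (v : Ambient d)) l 0, ?_, ?_, ?_⟩
    · intro y hy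
      obtain ⟨t, ht, rfl⟩ := Finset.mem_image.1 hy
      rw [hinj.extend_apply]
      exact h0 t ht
    · rw [Finset.sum_image hinj.injOn]
      exact (Finset.sum_congr rfl fun t _ => hinj.extend_apply _ _ _).trans h1
    · rw [Finset.sum_image hinj.injOn]
      exact (Finset.sum_congr rfl fun t _ => by rw [hinj.extend_apply]).trans h2

theorem euclideanHull_subset_linearSpan (T : Finset (USphere d)) :
    euclideanHull T ⊆ linearSpan T :=
  convexHull_min Submodule.subset_span (linearSpan T).convex

theorem inner_le_of_mem_euclideanHull {T : Finset (USphere d)} {w y : Ambient d} {c : ℝ}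
    (h : ∀ t ∈ T, inner ℝ (t : Ambient d) w ≤ c) (hy : y ∈ euclideanHull T) :
    inner ℝ y w ≤ c := by
  obtain ⟨l, h0, h1, rfl⟩ := mem_euclideanHull_iff.1 hy
  rw [sum_inner]
  refine (Finset.sum_le_sum fun t ht => ?_).trans_eq
    (by rw [← Finset.sum_mul, h1, one_mul] : ∑ t ∈ T, l t * c = c)
  rw [real_inner_smul_left]
  exact mul_le_mul_of_nonneg_left (h t ht) (h0 t ht)

theorem inner_eq_of_mem_euclideanHull {T : Finset (USphere d)} {w y : Ambient d} {c : ℝ}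
    (h : ∀ t ∈ T, inner ℝ (t : Ambient d) w = c) (hy : y ∈ euclideanHull T) :
    inner ℝ y w = c := by
  refine le_antisymm (inner_le_of_mem_euclideanHull (fun t ht => (h t ht).le) hy) ?_
  have := inner_le_of_mem_euclideanHull (w := -w) (c := -c)
    (fun t ht => by rw [inner_neg_right, h t ht]) hy
  rw [inner_neg_right] at this
  linarith

theorem norm_le_one_of_mem_euclideanHull {T : Finset (USphere d)} {y : Ambient d}
    (hy : y ∈ euclideanHull T) : ‖y‖ ≤ 1 := by
  have : euclideanHull T ⊆ closedBall 0 1 := convexHull_min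
    (by rintro _ ⟨t, -, rfl⟩; simp) (convex_closedBall _ _)
  simpa using this hy

/-- The face of a polytope cut out by a supporting hyperplane is spanned by the vertices on that
hyperplane. -/
theorem mem_euclideanHull_filter {R : Finset (USphere d)} {w y : Ambient d} {c : ℝ}
    (h : ∀ t ∈ R, inner ℝ (t : Ambient d) w ≤ c) (hy : y ∈ euclideanHull R)
    (hyc : inner ℝ y w = c) :
    y ∈ euclideanHull (R.filter fun t => inner ℝ (t : Ambient d) w = c) := by
  obtain ⟨l, h0, h1, rfl⟩ := mem_euclideanHull_iff.1 hy
  -- The weighted sum of the nonnegative slacks vanishes, so every vertex with positive slack has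
  -- weight zero.
  have hz : ∀ t ∈ R, inner ℝ (t : Ambient d) w ≠ c → l t = 0 := by
    have hs : ∑ t ∈ R, l t * (c - inner ℝ (t : Ambient d) w) = 0 := by
      simp_rw [mul_sub, Finset.sum_sub_distrib, ← Finset.sum_mul, h1, ← real_inner_smul_left]
      rw [← sum_inner, hyc]
      ring
    rw [Finset.sum_eq_zero_iff_of_nonneg
      fun t ht => mul_nonneg (h0 t ht) (sub_nonneg.2 (h t ht))] at hs
    intro t ht hne
    exact (mul_eq_zero.1 (hs t ht)).resolve_right (sub_ne_zero.2 hne.symm)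
  refine mem_euclideanHull_iff.2 ⟨l, fun t ht => h0 t (Finset.mem_filter.1 ht).1, ?_, ?_⟩
  · exact (Finset.sum_filter_of_ne fun t ht hl =>
      by_contra fun hne => hl (hz t ht hne)).trans h1
  · exact Finset.sum_filter_of_ne fun t ht hl =>
      by_contra fun hne => hl (by rw [hz t ht hne, zero_smul])

theorem euclideanHull_nonempty {T : Finset (USphere d)} {y : Ambient d}
    (hy : y ∈ euclideanHull T) : T.Nonempty := by
  by_contra h
  rw [Finset.not_nonempty_iff_eq_empty] at h
  simp [euclideanHull, h] at hy

/-- The tangent hyperplane at a supports the hull and touches the sphere only in a. -/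
theorem mem_of_coe_mem_euclideanHull {T : Finset (USphere d)} {a : USphere d}
    (h : (a : Ambient d) ∈ euclideanHull T) : a ∈ T := by
  have hle : ∀ t ∈ T, inner ℝ (t : Ambient d) (a : Ambient d) ≤ 1 := fun t _ =>
    (real_inner_le_norm _ _).trans (by simp)
  obtain ⟨t, ht⟩ := euclideanHull_nonempty (mem_euclideanHull_filter hle h a.inner_self)
  rw [Finset.mem_filter, inner_eq_one_iff_of_norm_eq_one t.norm_coe a.norm_coe] at ht
  exact Subtype.coe_injective ht.2 ▸ ht.1

/-- A point of the sphere that is not beyond the hyperplane through `T` and lies in the spherical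
simplex spanned by `T` is a vertex. -/
theorem mem_of_mem_sphericalSimplex {T : Finset (USphere d)} {a : USphere d} {w : Ambient d}
    (hT : ∀ t ∈ T, inner ℝ (t : Ambient d) w = 1) (ha : inner ℝ (a : Ambient d) w ≤ 1)
    (h : a ∈ sphericalSimplex T) : a ∈ T := by
  obtain ⟨r, hr, hra⟩ := mem_sphericalSimplex.1 h
  have h1 := inner_eq_of_mem_euclideanHull hT hra
  have h2 := norm_le_one_of_mem_euclideanHull hra
  rw [norm_smul, a.norm_coe, mul_one, Real.norm_of_nonneg hr.le] at h2
  rw [real_inner_smul_left] at h1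
  -- r ≤ 1 because the hull lies in the unit ball; r ≥ 1 because r⟨a,w⟩ = 1 and ⟨a,w⟩ ≤ 1.
  have h3 : r = 1 := le_antisymm h2 (by nlinarith)
  rw [h3, one_smul] at hra
  exact mem_of_coe_mem_euclideanHull hra

/-- The hyperplane keeps the compact hull away from the origin, so radial projection is continuous
on it and its image is compact. -/
theorem isClosed_sphericalSimplex {T : Finset (USphere d)} {w : Ambient d}
    (hT : ∀ t ∈ T, inner ℝ (t : Ambient d) w = 1) : IsClosed (sphericalSimplex T) := by
  have h0 : ∀ y ∈ euclideanHull T, ‖y‖ ≠ 0 := by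
    intro y hy h
    have := inner_eq_of_mem_euclideanHull hT hy
    rw [norm_eq_zero.1 h, inner_zero_left] at this
    exact zero_ne_one this
  have hc : IsCompact ((fun y : Ambient d => ‖y‖⁻¹ • y) '' euclideanHull T) :=
    (isCompact_euclideanHull T).image_of_continuousOn
      ((continuous_norm.continuousOn.inv₀ h0).smul continuousOn_id)
  have : sphericalSimplex T =
      (↑) ⁻¹' ((fun y : Ambient d => ‖y‖⁻¹ • y) '' euclideanHull T) := by
    ext x
    rw [mem_sphericalSimplex]
    constructor
    · rintro ⟨r, hr, hx⟩
      refine ⟨_, hx, ?_⟩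
      simp [norm_smul, abs_of_pos hr, smul_smul, hr.ne']
    · rintro ⟨y, hy, hyx⟩
      refine ⟨‖y‖, (norm_nonneg y).lt_of_ne' (h0 y hy), ?_⟩
      rw [← hyx]
      simpa [smul_smul, h0 y hy] using hy
  rw [this]
  exact hc.isClosed.preimage continuous_subtype_val

end Hull

/-! ### Genericity, and points avoiding low-dimensional spans. -/

section Generic
variable {d : ℕ}

theorem finrank_linearSpan_le (T : Finset (USphere d)) :
    Module.finrank ℝ (linearSpan T) ≤ T.card := by
  classical
  unfold linearSpan
  rw [← Finset.coe_image]
  exact (finrank_span_finset_le_card _).trans Finset.card_image_le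

theorem exists_subset_subsphere {V : Submodule ℝ (Ambient d)} (hV : V ≠ ⊤) :
    ∃ u : USphere d, ∀ x : USphere d, (x : Ambient d) ∈ V → x ∈ subsphere u 0 := by
  obtain ⟨w, hw, hw0⟩ := Submodule.exists_mem_ne_zero_of_ne_bot
    (mt (Submodule.orthogonal_eq_bot_iff (K := V)).1 hV)
  obtain ⟨u, hu⟩ := USphere.exists_smul_of_ne_zero hw0
  refine ⟨u, fun x hx => ?_⟩
  have h := (Submodule.mem_orthogonal V w).1 hw x hx
  rw [hu, real_inner_smul_right] at h
  exact (mul_eq_zero.1 h).resolve_left (norm_ne_zero_iff.2 hw0)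

theorem coe_mem_linearSpan {T : Finset (USphere d)} {t : USphere d} (ht : t ∈ T) :
    (t : Ambient d) ∈ linearSpan T := Submodule.subset_span ⟨t, ht, rfl⟩

theorem IsGenericOnSphere.linearSpan_eq_top {A : Set (USphere d)} (hA : IsGenericOnSphere A)
    {T : Finset (USphere d)} (hT : (T : Set (USphere d)) ⊆ A) (hc : T.card = d + 1) :
    linearSpan T = ⊤ := by
  by_contra h
  obtain ⟨u, hu⟩ := exists_subset_subsphere h
  exact hA.1 T hT hc ⟨u, fun t ht => hu t (coe_mem_linearSpan ht)⟩

theorem eq_of_linearSpan_eq_top {T : Finset (USphere d)} (hT : linearSpan T = ⊤)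
    {v w : Ambient d}
    (h : ∀ t ∈ T, inner ℝ (t : Ambient d) v = inner ℝ (t : Ambient d) w) : v = w := by
  refine ext_inner_left ℝ fun y => ?_
  have hy : y ∈ linearSpan T := hT ▸ Submodule.mem_top
  unfold linearSpan at hy
  induction hy using Submodule.span_induction with
  | mem y hy => obtain ⟨t, ht, rfl⟩ := hy; exact h t ht
  | zero => simp
  | add y z _ _ hy hz => rw [inner_add_left, inner_add_left, hy, hz]
  | smul c y _ hy => rw [real_inner_smul_left, real_inner_smul_left, hy]

/-- `d+1` linearly independent points lie on an affine hyperplane avoiding the origin. -/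
theorem exists_inner_eq_one {T : Finset (USphere d)} (hT : linearSpan T = ⊤)
    (hc : T.card = d + 1) :
    ∃ w : Ambient d, ∀ t ∈ T, inner ℝ (t : Ambient d) w = 1 := by
  let f : Ambient d →ₗ[ℝ] (T → ℝ) :=
    LinearMap.pi fun t => (innerSL ℝ ((t : USphere d) : Ambient d) : Ambient d →ₗ[ℝ] ℝ)
  have hf : Function.Injective f := by
    intro v w hvw
    exact eq_of_linearSpan_eq_top hT fun t ht => by simpa [f] using congrFun hvw ⟨t, ht⟩
  have hs : Function.Surjective f :=
    (LinearMap.injective_iff_surjective_of_finrank_eq_finrank (by simp [hc])).1 hf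
  obtain ⟨w, hw⟩ := hs fun _ => 1
  exact ⟨w, fun t ht => by simpa [f] using congrFun hw ⟨t, ht⟩⟩

/-- Points lying on an affine hyperplane that avoids the origin: there are at most `d+1`. -/
theorem IsGenericOnSphere.card_le {A : Set (USphere d)} (hA : IsGenericOnSphere A)
    {T : Finset (USphere d)} (hT : (T : Set (USphere d)) ⊆ A) {w : Ambient d}
    (hw : ∀ t ∈ T, inner ℝ (t : Ambient d) w = 1) : T.card ≤ d + 1 := by
  by_contra! h
  obtain ⟨S, hST, hS⟩ := Finset.exists_subset_card_eq (show d + 2 ≤ T.card by omega)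
  obtain ⟨s, hs⟩ := Finset.card_pos.1 (show 0 < S.card by omega)
  have hw0 : w ≠ 0 := by
    rintro rfl
    simpa using hw s (hST hs)
  obtain ⟨u, hu⟩ := USphere.exists_smul_of_ne_zero hw0
  refine hA.2 S ((Finset.coe_subset.2 hST).trans hT) hS ⟨u, ‖w‖⁻¹, fun t ht => ?_⟩
  have h1 := hw t (hST ht)
  rw [hu, real_inner_smul_right] at h1
  exact eq_inv_of_mul_eq_one_right h1

/-- A set S of at most d points whose span contains x extends to exactly d points; with x these lie
on a great-sphere. The bound d ≤ |A| makes the extension possible. -/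
theorem IsGenericWrt.avoidsSpans {A : Finset (USphere d)} {x : USphere d}
    (hd : d ≤ A.card) (hx : IsGenericWrt (A : Set (USphere d)) x) : AvoidsSpans A x := by
  classical
  intro S hS hSc hxS
  obtain ⟨S', hSS', hS'A, hS'c⟩ := Finset.exists_subsuperset_card_eq hS hSc hd
  have hne : linearSpan S' ≠ ⊤ := by
    intro h
    have := finrank_linearSpan_le S'
    rw [h, finrank_top, finrank_euclideanSpace_fin] at this
    omega
  obtain ⟨u, hu⟩ := exists_subset_subsphere hne
  have hxS' : (x : Ambient d) ∈ linearSpan S' :=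
    Submodule.span_mono (image_mono (Finset.coe_subset.2 hSS')) hxS
  refine hx.2.1 (insert x S') ?_ ?_ ⟨u, ?_⟩
  · rw [Finset.coe_insert]
    exact insert_subset_insert (Finset.coe_subset.2 hS'A)
  · rw [Finset.card_insert_of_notMem fun h => hx.1 (hS'A h), hS'c]
  · intro t ht
    rcases Finset.mem_insert.1 (Finset.mem_coe.1 ht) with rfl | ht
    · exact hu _ hxS'
    · exact hu _ (coe_mem_linearSpan ht)

theorem AvoidsSpans.lt_card {A S : Finset (USphere d)} {x : USphere d} (hx : AvoidsSpans A x)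
    (hS : S ⊆ A) {r : ℝ} (hr : r ≠ 0) (h : r • (x : Ambient d) ∈ euclideanHull S) :
    d < S.card := by
  by_contra! hc
  exact hx S hS hc ((Submodule.smul_mem_iff _ hr).1 (euclideanHull_subset_linearSpan S h))

/-- The surface measure of a set is a multiple of the volume of its cone, and here each cone lies in
a proper subspace. -/
theorem ae_avoidsSpans (A : Finset (USphere d)) :
    ∀ᵐ x ∂(volume : Measure (Ambient d)).toSphere, AvoidsSpans A x := by
  have key : ∀ S ∈ A.powerset, ∀ᵐ x : USphere d ∂(volume : Measure (Ambient d)).toSphere,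
      S.card ≤ d → (x : Ambient d) ∉ linearSpan S := by
    intro S _
    by_cases hS : S.card ≤ d
    · have hne : linearSpan S ≠ ⊤ := by
        intro h
        have := finrank_linearSpan_le S
        rw [h, finrank_top, finrank_euclideanSpace_fin] at this
        omega
      have h0 : (volume : Measure (Ambient d)).toSphere
          {x : USphere d | (x : Ambient d) ∈ linearSpan S} = 0 := by
        have hm : MeasurableSet {x : USphere d | (x : Ambient d) ∈ linearSpan S} :=
          ((linearSpan S).closed_of_finiteDimensional.preimage
            continuous_subtype_val).measurableSet
        rw [Measure.toSphere_apply' _ hm]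
        refine mul_eq_zero_of_right _ (measure_mono_null ?_
          (Measure.addHaar_submodule volume (linearSpan S) hne))
        rintro _ ⟨r, -, _, ⟨x, hx, rfl⟩, rfl⟩
        exact (linearSpan S).smul_mem r hx
      filter_upwards [measure_eq_zero_iff_ae_notMem.1 h0] with x hx _ using hx
    · exact Filter.Eventually.of_forall fun x h => absurd h hS
  have := (Filter.eventually_all_finset A.powerset).2 key
  filter_upwards [this] with x hx S hS using hx S (Finset.mem_powerset.2 hS)

theorem dense_avoidsSpans (A : Finset (USphere d)) : Dense {x | AvoidsSpans A x} :=
  Measure.dense_of_ae (ae_avoidsSpans A)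

end Generic

/-! ### Delaunay simplices as facets of the convex hull. -/

section Delaunay
variable {d : ℕ}

theorem exists_inner_of_strongDual (f : StrongDual ℝ (Ambient d)) :
    ∃ w : Ambient d, ∀ y, f y = inner ℝ y w :=
  ⟨(InnerProductSpace.toDual ℝ _).symm f, fun y => by
    rw [real_inner_comm, InnerProductSpace.toDual_symm_apply]⟩

/-- If every open hemisphere contains a point of `R`, then the origin is an interior point of the
convex hull of `R`. -/
theorem exists_ball_subset_euclideanHull {R : Finset (USphere d)}
    (hR : ∀ u : USphere d, ∃ a ∈ R, 0 < sinner a u) :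
    ∃ δ > 0, ball (0 : Ambient d) δ ⊆ euclideanHull R := by
  have : Nonempty (USphere d) := (NormedSpace.sphere_nonempty.2 zero_le_one).to_subtype
  have hne : R.Nonempty := by
    obtain ⟨a, ha, -⟩ := hR (Classical.arbitrary _)
    exact ⟨a, ha⟩
  have hcont : Continuous fun u : USphere d => R.sup' hne fun a => sinner a u :=
    Continuous.finset_sup'_apply hne fun a _ => by unfold sinner; fun_prop
  obtain ⟨u₀, -, hu₀⟩ := isCompact_univ.exists_isMinOn univ_nonempty hcont.continuousOn
  -- The radius is the minimum over the sphere of the support function u ↦ max ⟨a,u⟩; a point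
  -- separated from the hull has at least this norm.
  refine ⟨_, (?_ : 0 < R.sup' hne fun a => sinner a u₀), fun y hy => ?_⟩
  · obtain ⟨a, ha, h⟩ := hR u₀
    exact h.trans_le (Finset.le_sup' (fun a => sinner a u₀) ha)
  · by_contra hyR
    obtain ⟨f, s, hs, hsy⟩ := geometric_hahn_banach_closed_point (convex_euclideanHull R)
      (isCompact_euclideanHull R).isClosed hyR
    obtain ⟨w, hw⟩ := exists_inner_of_strongDual f
    have hw0 : w ≠ 0 := by
      rintro rfl
      obtain ⟨a, ha⟩ := hne
      have := (hs a (coe_mem_euclideanHull ha)).trans hsy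
      rw [hw, hw, inner_zero_right, inner_zero_right] at this
      exact lt_irrefl _ this
    obtain ⟨u, hu⟩ := USphere.exists_smul_of_ne_zero hw0
    have hwpos := norm_pos_iff.2 hw0
    obtain ⟨a, ha, hau⟩ := Finset.exists_mem_eq_sup' hne fun a => sinner a u
    have h1 : (R.sup' hne fun a => sinner a u₀) ≤ sinner a u := hau ▸ hu₀ (mem_univ u)
    have h2 : sinner a u < inner ℝ y (u : Ambient d) := by
      have := (hs a (coe_mem_euclideanHull ha)).trans hsy
      rw [hw, hw, hu, real_inner_smul_right, real_inner_smul_right] at this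
      exact lt_of_mul_lt_mul_left this hwpos.le
    have h3 : inner ℝ y (u : Ambient d) ≤ ‖y‖ := by
      simpa using real_inner_le_norm y (u : Ambient d)
    rw [mem_ball_zero_iff] at hy
    linarith

/-- Every ray from the origin leaves the convex hull of `R` through a supporting hyperplane. -/
theorem exists_supporting_hyperplane {R : Finset (USphere d)}
    (hR : ∀ u : USphere d, ∃ a ∈ R, 0 < sinner a u) (x : USphere d) :
    ∃ (r : ℝ) (w : Ambient d), 0 < r ∧ r • (x : Ambient d) ∈ euclideanHull R ∧
      inner ℝ (r • (x : Ambient d)) w = 1 ∧ ∀ b ∈ R, inner ℝ (b : Ambient d) w ≤ 1 := by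
  obtain ⟨δ, hδ, hball⟩ := exists_ball_subset_euclideanHull hR
  have hcont : Continuous fun r : ℝ => r • (x : Ambient d) := by fun_prop
  have hbound : ∀ r : ℝ, r • (x : Ambient d) ∈ euclideanHull R → |r| ≤ 1 := fun r h => by
    simpa [norm_smul] using norm_le_one_of_mem_euclideanHull h
  have hK : IsCompact {r : ℝ | r • (x : Ambient d) ∈ euclideanHull R} :=
    (isCompact_Icc (a := -1) (b := 1)).of_isClosed_subset
      ((isCompact_euclideanHull R).isClosed.preimage hcont) fun r h => abs_le.1 (hbound r h)
  have hδ2 : (δ / 2) • (x : Ambient d) ∈ euclideanHull R := by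
    apply hball
    simp only [mem_ball_zero_iff, norm_smul, x.norm_coe, mul_one]
    rw [Real.norm_of_nonneg (by positivity)]
    linarith
  obtain ⟨r, hr, hmax⟩ := hK.exists_isGreatest ⟨_, hδ2⟩
  have hr0 : 0 < r := (half_pos hδ).trans_le (hmax hδ2)
  -- r is the largest parameter for which the ray is still in the hull.
  have hint : r • (x : Ambient d) ∉ interior (euclideanHull R) := by
    intro h
    have h1 : ∀ᶠ s in 𝓝 r, s • (x : Ambient d) ∈ interior (euclideanHull R) :=
      hcont.continuousAt.eventually (isOpen_interior.mem_nhds h)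
    obtain ⟨s, hs, hrs⟩ := ((h1.filter_mono nhdsWithin_le_nhds).and
      (self_mem_nhdsWithin : Ioi r ∈ 𝓝[>] r)).exists
    exact (hmax (interior_subset hs : s • (x : Ambient d) ∈ euclideanHull R)).not_gt hrs
  have h0 : (0 : Ambient d) ∈ interior (euclideanHull R) :=
    mem_interior.2 ⟨_, hball, isOpen_ball, mem_ball_self hδ⟩
  obtain ⟨f, hf0, hf⟩ := geometric_hahn_banach_of_nonempty_interior_point
    (convex_euclideanHull R) hint ⟨0, h0⟩
  obtain ⟨w, hw⟩ := exists_inner_of_strongDual f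
  have hw0 : w ≠ 0 := by
    rintro rfl
    exact hf0 (ContinuousLinearMap.ext fun y => by simp [hw])
  obtain ⟨u, hu⟩ := USphere.exists_smul_of_ne_zero hw0
  -- The exit point maximises ⟨·,w⟩ on the hull, and some point of R lies in the open hemisphere
  -- about w. Hence w can be normalised to the value 1.
  have hpos : 0 < inner ℝ (r • (x : Ambient d)) w := by
    obtain ⟨a, ha, hau⟩ := hR u
    have h1 := hf a (coe_mem_euclideanHull ha)
    rw [hw, hw] at h1
    refine lt_of_lt_of_le ?_ h1
    rw [hu, real_inner_smul_right]
    exact mul_pos (norm_pos_iff.2 hw0) hau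
  refine ⟨r, (inner ℝ (r • (x : Ambient d)) w)⁻¹ • w, hr0, hr, ?_, fun b hb => ?_⟩
  · rw [real_inner_smul_right, inv_mul_cancel₀ hpos.ne']
  · have h1 := hf b (coe_mem_euclideanHull hb)
    rw [hw, hw] at h1
    rw [real_inner_smul_right, ← div_eq_inv_mul]
    exact (div_le_one hpos).2 h1

/-- The Delaunay simplices of a set meeting all open hemispheres cover every point that avoids
the spans of the lower-dimensional faces exactly once. -/
theorem existsUnique_delaunay {A R : Finset (USphere d)} {x : USphere d}
    (hA : IsGenericOnSphere (A : Set (USphere d))) (hx : AvoidsSpans A x) (hRA : R ⊆ A)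
    (hR : ∀ u : USphere d, ∃ a ∈ R, 0 < sinner a u) :
    ∃! T : Finset (USphere d), T ⊆ R ∧ T.card = d + 1 ∧ x ∈ sphericalSimplex T ∧
      ∃ w : Ambient d, (∀ t ∈ T, inner ℝ (t : Ambient d) w = 1) ∧
        ∀ b ∈ R, inner ℝ (b : Ambient d) w ≤ 1 := by
  obtain ⟨r, w, hr, hrx, hrw, hw⟩ := exists_supporting_hyperplane hR x
  have hcard : ∀ {v : Ambient d}, (∀ b ∈ R, inner ℝ (b : Ambient d) v ≤ 1) →
      (R.filter fun t : USphere d => inner ℝ (t : Ambient d) v = 1).card ≤ d + 1 := fun _ =>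
    hA.card_le (Finset.coe_subset.2 ((Finset.filter_subset _ _).trans hRA))
      fun t ht => (Finset.mem_filter.1 ht).2
  refine ⟨R.filter fun t : USphere d => inner ℝ (t : Ambient d) w = 1, ⟨Finset.filter_subset _ _, ?_,
    ⟨r, hr, mem_euclideanHull_filter hw hrx hrw⟩, w,
    fun t ht => (Finset.mem_filter.1 ht).2, hw⟩, ?_⟩
  · exact le_antisymm (hcard hw) (hx.lt_card ((Finset.filter_subset _ _).trans hRA) hr.ne'
      (mem_euclideanHull_filter hw hrx hrw))
  · rintro T ⟨hTR, hTc, hTx, v, hTv, hv⟩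
    obtain ⟨s, hs, hsx⟩ := mem_sphericalSimplex.1 hTx
    have hsv := inner_eq_of_mem_euclideanHull hTv hsx
    have h1 := inner_le_of_mem_euclideanHull hv hrx
    have h2 := inner_le_of_mem_euclideanHull (fun t ht => hw t (hTR ht)) hsx
    -- Each of the two supporting hyperplanes bounds the parameter at which the ray meets the other.
    have hrs : s = r := by
      rw [real_inner_smul_left] at hsv h1 hrw h2
      have hxv : 0 < inner ℝ (x : Ambient d) v := by
        by_contra! h
        nlinarith
      have hxw : 0 < inner ℝ (x : Ambient d) w := by
        by_contra! h
        nlinarith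
      exact le_antisymm (le_of_mul_le_mul_right (h2.trans_eq hrw.symm) hxw)
        (le_of_mul_le_mul_right (h1.trans_eq hsv.symm) hxv)
    subst hrs
    -- The exit point lies in the hull of those vertices of T that are on the hyperplane of w. As x
    -- avoids spans, these number at least d+1, so they are all of T.
    have hface := mem_euclideanHull_filter (fun t ht => hw t (hTR ht)) hsx hrw
    have hlt := hx.lt_card (((Finset.filter_subset _ _).trans hTR).trans hRA) hs.ne' hface
    refine Finset.eq_of_subset_of_card_le (fun t ht => ?_) (by rw [hTc]; exact hcard hw)
    have hTeq := Finset.eq_of_subset_of_card_le (Finset.filter_subset _ T)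
      (by rw [hTc]; exact hlt)
    rw [← hTeq, Finset.mem_filter] at ht
    exact Finset.mem_filter.2 ⟨hTR ht.1, ht.2⟩

end Delaunay

/-! ### Hefty simplices and the cover number at points avoiding spans. -/

section Count
variable {d : ℕ}

/-- With w = u/c, the cap c < ⟨b,u⟩ is the half-space 1 < ⟨b,w⟩ beyond the hyperplane of T. Since T
spans, w is determined by T, and so are u and c > 0. -/
theorem mem_heftySimplices_iff {A : Finset (USphere d)}
    (hA : IsGenericOnSphere (A : Set (USphere d))) {k : ℕ} {T : Finset (USphere d)}
    (hTA : T ⊆ A) (hTc : T.card = d + 1) {w : Ambient d}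
    (hw : ∀ t ∈ T, inner ℝ (t : Ambient d) w = 1) :
    T ∈ heftySimplices k (A : Set (USphere d)) ↔
      (A.filter fun b : USphere d => 1 < inner ℝ (b : Ambient d) w).card = k := by
  have key : ∀ (u : USphere d) (c : ℝ), 0 < c → w = c⁻¹ • (u : Ambient d) →
      ((A : Set (USphere d)) ∩ openCap u c).encard =
        (A.filter fun b : USphere d => 1 < inner ℝ (b : Ambient d) w).card := by
    intro u c hc hwu
    rw [← Set.encard_coe_eq_coe_finsetCard]
    congr 1
    ext b
    simp only [openCap, sinner, mem_inter_iff, Finset.mem_coe, Finset.coe_filter, mem_ofPred_eq]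
    rw [hwu, real_inner_smul_right, ← div_eq_inv_mul, one_lt_div hc]
  constructor
  · rintro ⟨-, -, u, c, hc, hTu, hk⟩
    have hwu : w = c⁻¹ • (u : Ambient d) := by
      refine eq_of_linearSpan_eq_top (hA.linearSpan_eq_top (Finset.coe_subset.2 hTA) hTc)
        fun t ht => ?_
      have : inner ℝ (t : Ambient d) (u : Ambient d) = c := hTu ht
      rw [hw t ht, real_inner_smul_right, this, inv_mul_cancel₀ hc.ne']
    rw [key u c hc hwu] at hk
    exact_mod_cast hk
  · intro hk
    obtain ⟨t, ht⟩ := Finset.card_pos.1 (show 0 < T.card by omega)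
    have hw0 : w ≠ 0 := by
      rintro rfl
      simpa using hw t ht
    have hpos := norm_pos_iff.2 hw0
    obtain ⟨u, hu⟩ := USphere.exists_smul_of_ne_zero hw0
    refine ⟨Finset.coe_subset.2 hTA, hTc, u, ‖w‖⁻¹, inv_pos.2 hpos, fun t ht => ?_, ?_⟩
    · have h1 := hw t ht
      rw [hu, real_inner_smul_right] at h1
      exact eq_inv_of_mul_eq_one_right h1
    · rw [key u ‖w‖⁻¹ (inv_pos.2 hpos) (by rwa [inv_inv]), hk]

theorem IsBalanced.lt_card {A : Finset (USphere d)} {k : ℕ}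
    (hA : IsBalanced k (A : Set (USphere d))) : k < A.card := by
  have : Nonempty (USphere d) := (NormedSpace.sphere_nonempty.2 zero_le_one).to_subtype
  have := (hA (Classical.arbitrary _)).trans (encard_le_encard inter_subset_left)
  rw [encard_coe_eq_coe_finsetCard] at this
  exact_mod_cast this

/-- Each open hemisphere has k+1 points of A, so deleting k leaves at least one. -/
theorem IsBalanced.exists_mem_sdiff [DecidableEq (USphere d)] {A M : Finset (USphere d)} {k : ℕ}
    (hA : IsBalanced k (A : Set (USphere d))) (hM : M.card ≤ k) (u : USphere d) :
    ∃ a ∈ A \ M, 0 < sinner a u := by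
  by_contra! h
  have hsub : (A : Set (USphere d)) ∩ openCap u 0 ⊆ M := by
    rintro a ⟨ha, hau⟩
    by_contra haM
    exact (h a (Finset.mem_sdiff.2 ⟨ha, haM⟩)).not_gt hau
  have := (hA u).trans (encard_le_encard hsub)
  rw [encard_coe_eq_coe_finsetCard] at this
  have : k + 1 ≤ M.card := by exact_mod_cast this
  omega

/-- The number of `k`-hefty simplices with vertices `B` that cover `x`, provided that all
Delaunay simplices of subsets containing `B` that cover `x` have vertices `B`. -/
theorem coverNumber_heftySimplices {A B : Finset (USphere d)} {k : ℕ} {x : USphere d}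
    (hA : IsGenericOnSphere (A : Set (USphere d))) (hbal : IsBalanced k (A : Set (USphere d)))
    (hx : AvoidsSpans A x) (hBA : B ⊆ A) (hB : B.card ≤ 1)
    (hloc : ∀ T ⊆ A, T.card = d + 1 → x ∈ sphericalSimplex T → ∀ w : Ambient d,
      (∀ t ∈ T, inner ℝ (t : Ambient d) w = 1) →
      (∀ b ∈ B, inner ℝ (b : Ambient d) w ≤ 1) → B ⊆ T) :
    coverNumber {T | T ∈ heftySimplices k (A : Set (USphere d)) ∧ B ⊆ T} x =
      (d + 1 - B.card).multichoose k := by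
  classical
  have hw : ∀ T : Finset (USphere d), ∃ w : Ambient d, T ⊆ A → T.card = d + 1 →
      ∀ t ∈ T, inner ℝ (t : Ambient d) w = 1 := by
    intro T
    by_cases h : T ⊆ A ∧ T.card = d + 1
    · obtain ⟨w, hw⟩ := exists_inner_eq_one
        (hA.linearSpan_eq_top (Finset.coe_subset.2 h.1) h.2) h.2
      exact ⟨w, fun _ _ => hw⟩
    · exact ⟨0, fun h1 h2 => absurd ⟨h1, h2⟩ h⟩
  choose w hw using hw
  set S := (A.powersetCard (d + 1)).filter fun T => x ∈ sphericalSimplex T ∧ B ⊆ T with hS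
  have hmem : ∀ {T}, T ∈ S ↔ (T ⊆ A ∧ T.card = d + 1) ∧ x ∈ sphericalSimplex T ∧ B ⊆ T := by
    intro T
    rw [hS, Finset.mem_filter, Finset.mem_powersetCard]
  set O : Finset (USphere d) → Finset (USphere d) :=
    fun T => A.filter fun b : USphere d => 1 < inner ℝ (b : Ambient d) (w T) with hO
  have hOT : ∀ T ∈ S, Disjoint T (O T) := by
    intro T hT
    rw [hmem] at hT
    refine Finset.disjoint_left.2 fun t ht htO => ?_
    exact (Finset.mem_filter.1 htO).2.ne' (hw T hT.1.1 hT.1.2 t ht)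
  have hcount : coverNumber {T | T ∈ heftySimplices k (A : Set (USphere d)) ∧ B ⊆ T} x =
      (S.filter fun T => (O T).card = k).card := by
    rw [coverNumber, ← Set.encard_coe_eq_coe_finsetCard]
    congr 1
    ext T
    simp only [mem_ofPred_eq, Finset.coe_filter, hmem]
    constructor
    · rintro ⟨⟨h1, h2⟩, h3⟩
      have hTA : T ⊆ A := Finset.coe_subset.1 h1.1
      exact ⟨⟨⟨hTA, h1.2.1⟩, h3, h2⟩,
        (mem_heftySimplices_iff hA hTA h1.2.1 (hw T hTA h1.2.1)).1 h1⟩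
    · rintro ⟨⟨⟨h1, h2⟩, h3, h4⟩, h5⟩
      exact ⟨⟨(mem_heftySimplices_iff hA h1 h2 (hw T h1 h2)).2 h5, h4⟩, h3⟩
  -- The vertices in B are never deleted: M ranges over subsets of A \ B, and only the d+1-|B| other
  -- vertices of T have to avoid M.
  rw [hcount, Finset.card_filter_card_eq_multichoose S (A \ B) (fun T => T \ B) O
    (d + 1 - B.card) k]
  · intro T hT
    exact Finset.sdiff_subset_sdiff (hmem.1 hT).1.1 le_rfl
  · intro T hT
    exact Finset.subset_sdiff.2 ⟨Finset.filter_subset _ _,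
      ((hOT T hT).mono_left (hmem.1 hT).2.2).symm⟩
  · intro T hT
    exact (hOT T hT).mono_left Finset.sdiff_subset
  · intro T hT
    rw [Finset.card_sdiff_of_subset (hmem.1 hT).2.2, (hmem.1 hT).1.2]
  · rw [Finset.card_sdiff_of_subset hBA]
    have := hbal.lt_card
    omega
  · intro M hM hMk
    have hMB := Finset.subset_sdiff.1 hM
    obtain ⟨T, ⟨hT, hTc, hTx, v, hTv, hv⟩, huniq⟩ := existsUnique_delaunay hA hx
      (Finset.sdiff_subset : A \ M ⊆ A) (hbal.exists_mem_sdiff hMk)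
    have hTAM := Finset.subset_sdiff.1 hT
    have hTw : w T = v := eq_of_linearSpan_eq_top
      (hA.linearSpan_eq_top (Finset.coe_subset.2 hTAM.1) hTc)
      fun t ht => by rw [hw T hTAM.1 hTc t ht, hTv t ht]
    -- B survives in A \ M, so it is not beyond the hyperplane of T, and `hloc` gives B ⊆ T.
    refine ⟨T, ⟨hmem.2 ⟨⟨hTAM.1, hTc⟩, hTx, hloc T hTAM.1 hTc hTx v hTv fun b hb =>
      hv b (Finset.mem_sdiff.2 ⟨hBA hb, fun h => Finset.disjoint_left.1 hMB.2 h hb⟩)⟩, ?_,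
      hTAM.2.symm.mono_right Finset.sdiff_subset⟩, ?_⟩
    · intro b hb
      by_contra hbM
      have hb' := Finset.mem_filter.1 hb
      exact (hv b (Finset.mem_sdiff.2 ⟨hb'.1, hbM⟩)).not_gt (hTw ▸ hb'.2)
    -- Conversely, O(T') ⊆ M says that no point of A \ M is beyond T', so T' is a Delaunay simplex
    -- of A \ M.
    · rintro T' ⟨hT', hOM, hdisj⟩
      rw [hmem] at hT'
      refine huniq T' ⟨Finset.subset_sdiff.2 ⟨hT'.1.1, ?_⟩, hT'.1.2, hT'.2.1, w T',
        hw T' hT'.1.1 hT'.1.2, fun b hb => ?_⟩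
      · refine Finset.disjoint_left.2 fun t ht htM => ?_
        exact Finset.disjoint_left.1 hdisj htM
          (Finset.mem_sdiff.2 ⟨ht, Finset.disjoint_left.1 hMB.2 htM⟩)
      · by_contra! h
        rw [Finset.mem_sdiff] at hb
        exact hb.2 (hOM (Finset.mem_filter.2 ⟨hb.1, h⟩))

end Count

/-! ### From points avoiding spans to all points. -/

section Covering
variable {d : ℕ}

theorem isClosed_of_mem_heftySimplices {A : Set (USphere d)} {k : ℕ} {T : Finset (USphere d)}
    (hT : T ∈ heftySimplices k A) : IsClosed (sphericalSimplex T) := by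
  obtain ⟨-, -, u, c, hc, hTu, -⟩ := hT
  refine isClosed_sphericalSimplex (w := c⁻¹ • (u : Ambient d)) fun t ht => ?_
  have : inner ℝ (t : Ambient d) (u : Ambient d) = c := hTu ht
  rw [real_inner_smul_right, this, inv_mul_cancel₀ hc.ne']

theorem finite_heftySimplices (k : ℕ) (A : Finset (USphere d)) :
    (heftySimplices k (A : Set (USphere d))).Finite :=
  A.powerset.finite_toSet.subset fun _ hT =>
    Finset.mem_coe.2 (Finset.mem_powerset.2 (Finset.coe_subset.1 hT.1))

/-- A finite family of closed simplices that covers the points of an open set `V` avoiding the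
spans exactly `N` times covers every subset of `V` exactly `N` times. -/
theorem coversExactly_of_avoidsSpans {A : Finset (USphere d)} (hd : d ≤ A.card)
    {F : Set (Finset (USphere d))} (hF : F.Finite) (hcl : ∀ T ∈ F, IsClosed (sphericalSimplex T))
    {N : ℕ} {V U : Set (USphere d)} (hV : IsOpen V) (hUV : U ⊆ V)
    (h : ∀ x ∈ V, AvoidsSpans A x → coverNumber F x = N) :
    CoversExactly (A : Set (USphere d)) F N U := by
  -- Upper semicontinuity of the cover number: W omits the finitely many closed simplices that miss
  -- x.
  have hW : ∀ x ∈ V, ∃ W, IsOpen W ∧ x ∈ W ∧ ∀ y ∈ W, y ∈ V ∧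
      ∀ T ∈ F, y ∈ sphericalSimplex T → x ∈ sphericalSimplex T := by
    intro x hx
    refine ⟨V ∩ (⋃ T ∈ {T ∈ F | x ∉ sphericalSimplex T}, sphericalSimplex T)ᶜ,
      hV.inter ((hF.subset (sep_subset _ _)).isClosed_biUnion
        fun T hT => hcl T hT.1).isOpen_compl, ⟨hx, ?_⟩, ?_⟩
    · simp only [mem_compl_iff, mem_iUnion, not_exists]
      exact fun T hT hxT => hT.2 hxT
    · rintro y ⟨hyV, hy⟩
      refine ⟨hyV, fun T hT hyT => by_contra fun hxT => hy ?_⟩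
      exact mem_biUnion (show T ∈ {T ∈ F | x ∉ sphericalSimplex T} from ⟨hT, hxT⟩) hyT
  refine ⟨fun x hx => ?_, fun x hx hgx => h x (hUV hx) (hgx.avoidsSpans hd), ?_, ?_⟩
  · obtain ⟨W, hWo, hxW, hWy⟩ := hW x (hUV hx)
    obtain ⟨y, hyW, hy⟩ := (dense_avoidsSpans A).inter_open_nonempty W hWo ⟨x, hxW⟩
    rw [← h y (hWy y hyW).1 hy]
    exact encard_le_encard fun T hT => ⟨hT.1, (hWy y hyW).2 T hT.1 hT.2⟩
  · filter_upwards [ae_avoidsSpans A] with x hx hxU using h x (hUV hxU) hx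
  · rintro x hx ⟨T, hT, hxT⟩
    obtain ⟨W, hWo, hxW, hWy⟩ := hW x (hUV hx)
    -- Near a frontier point some y avoiding spans lies outside T; then x is in all the simplices
    -- containing y, and in T as well.
    have hne : (W ∩ (sphericalSimplex T)ᶜ).Nonempty := by
      rw [frontier_eq_closure_inter_closure] at hxT
      exact mem_closure_iff.1 hxT.2 W hWo hxW
    obtain ⟨y, ⟨hyW, hyT⟩, hy⟩ := (dense_avoidsSpans A).inter_open_nonempty _
      (hWo.inter (hcl T hT).isOpen_compl) hne
    rw [← h y (hWy y hyW).1 hy]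
    refine (hF.subset fun S hS => hS.1).encard_lt_encard (ssubset_iff_exists.2
      ⟨fun S hS => ⟨hS.1, (hWy y hyW).2 S hS.1 hS.2⟩, T, ⟨hT, ?_⟩, fun hT' => hyT hT'.2⟩)
    exact (hcl T hT).frontier_subset hxT

end Covering

/-! ### The global and the local covering statement. -/

/-- A single Delaunay simplex of A already has d+1 vertices. -/
theorem IsBalanced.le_card {d k : ℕ} {A : Finset (USphere d)}
    (hA : IsGenericOnSphere (A : Set (USphere d))) (hbal : IsBalanced k (A : Set (USphere d))) :
    d ≤ A.card := by
  classical
  have : Nonempty (USphere d) := (NormedSpace.sphere_nonempty.2 zero_le_one).to_subtype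
  obtain ⟨x, hx⟩ := (dense_avoidsSpans A).nonempty
  obtain ⟨T, hT, -⟩ := existsUnique_delaunay hA hx (Finset.sdiff_subset : A \ ∅ ⊆ A)
    (hbal.exists_mem_sdiff (by simp))
  have := Finset.card_le_card (hT.1.trans Finset.sdiff_subset)
  omega

theorem theorem3p2 (d k : ℕ) (hd : 1 ≤ d) (A : Set (USphere d)) (hfin : A.Finite)
    (hgen : IsGenericOnSphere A) (hbal : IsBalanced k A) :
    CoversExactly A (heftySimplices k A) ((d + k).choose d) Set.univ ∧
    ∀ a ∈ A, ∃ ε : ℝ, 0 < ε ∧ ∀ U ∈ 𝓝 a, U ⊆ Metric.ball a ε →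
      CoversExactly A {T | T ∈ heftySimplices k A ∧ a ∈ T} ((d + k - 1).choose (d - 1)) U := by
  lift A to Finset (USphere d) using hfin
  have hdA := hbal.le_card hgen
  refine ⟨coversExactly_of_avoidsSpans hdA (finite_heftySimplices k A)
    (fun T hT => isClosed_of_mem_heftySimplices hT) isOpen_univ (subset_univ _)
    fun x _ hx => ?_, fun a ha => ?_⟩
  · have h := coverNumber_heftySimplices (B := ∅) hgen hbal hx (Finset.empty_subset A) (by simp)
      fun _ _ _ _ _ _ _ => Finset.empty_subset _
    simp only [Finset.empty_subset, and_true, Finset.card_empty, Nat.sub_zero, ofPred_mem_eq]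
      at h
    rw [h, Nat.multichoose_eq, show d + 1 + k - 1 = d + k by omega, Nat.choose_symm_add]
  -- The ball about a is chosen to miss every simplex on d+1 points of A that misses a. Thus a
  -- simplex covering x in the ball contains a, and a is then a vertex unless it lies beyond the
  -- hyperplane.
  · have hZ : IsClosed (⋃ T ∈ {T : Finset (USphere d) |
        (T ⊆ A ∧ T.card = d + 1) ∧ a ∉ sphericalSimplex T}, sphericalSimplex T) := by
      refine (A.powerset.finite_toSet.subset fun T hT =>
        Finset.mem_coe.2 (Finset.mem_powerset.2 hT.1.1)).isClosed_biUnion fun T hT => ?_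
      obtain ⟨w, hw⟩ := exists_inner_eq_one
        (hgen.linearSpan_eq_top (Finset.coe_subset.2 hT.1.1) hT.1.2) hT.1.2
      exact isClosed_sphericalSimplex hw
    obtain ⟨ε, hε, hball⟩ := Metric.isOpen_iff.1 hZ.isOpen_compl a (by
      simp only [mem_compl_iff, mem_iUnion, not_exists]
      exact fun T hT haT => hT.2 haT)
    refine ⟨ε, hε, fun U _ hU => coversExactly_of_avoidsSpans hdA
      ((finite_heftySimplices k A).subset fun T hT => hT.1)
      (fun T hT => isClosed_of_mem_heftySimplices hT.1) isOpen_ball hU fun x hx hxA => ?_⟩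
    have h := coverNumber_heftySimplices (B := {a}) hgen hbal hxA
      (Finset.singleton_subset_iff.2 ha) (by simp) ?_
    · simp only [Finset.singleton_subset_iff, Finset.card_singleton, Nat.add_sub_cancel] at h
      rw [h, Nat.multichoose_eq, Nat.choose_symm_of_eq_add (show d + k - 1 = k + (d - 1) by omega)]
    · intro T hTA hTc hxT w hTw haw
      refine Finset.singleton_subset_iff.2 (mem_of_mem_sphericalSimplex hTw
        (haw a (Finset.mem_singleton_self a)) (by_contra fun haT => hball hx ?_))
      exact mem_biUnion (show T ∈ {T : Finset (USphere d) |
        (T ⊆ A ∧ T.card = d + 1) ∧ a ∉ sphericalSimplex T} from ⟨⟨hTA, hTc⟩, haT⟩) hxT
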